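/- **Setting.** All Hilbert spaces are finite-dimensional and complex, $\mathcal L(\mathcal H)$ is the space of linear operators on $\mathcal H$, and $\mathcal S(\mathcal H)$ is the set of density operators (nonnegative operators of trace one). A quantum operation from $\mathcal H_A$ to $\mathcal H_B$ is a completely positive, trace-preserving linear map $\mathcal E:\mathcal L(\mathcal H_A)\to\mathcal L(\mathcal H_B)$; $\mathcal I_A$ is the identity operation. The support of a density operator is its range. For a subspace $\mathcal K_A\subseteq\mathcal H_A$, let $\mathcal S(\mathcal K_A)$ be the set of $\rho\in\mathcal S(\mathcal H_A)$ whose support is contained in $\mathcal K_A$. The operation $\mathcal E$ is *reversible* with respect to $\mathcal S(\mathcal K_A)$ if there is a quantum operation $\mathcal R$ from $\mathcal H_B$ to $\mathcal H_A$ with $\mathcal R\mathcal E(\rho)=\rho$ for all $\rho\in\mathcal S(\mathcal K_A)$, and *vanishing* with respect to $\mathcal S(\mathcal K_A)$ if there is $\rho_0\in\mathcal S(\mathcal H_B)$ with $\mathcal E(\rho)=\rho_0$ for all $\rho\in\mathcal S(\mathcal K_A)$. For $\rho_A\in\mathcal S(\mathcal H_A)$, a purification of $\rho_A$ is a vector $\Psi\in\mathcal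 H_R\otimes\mathcal H_A$, for some reference space $\mathcal H_R$, with $\mathrm{Tr}_R|\Psi\rangle\langle\Psi|=\rho_A$. With $\rho_{RB}=(\mathcal I_R\otimes\mathcal E)(|\Psi\rangle\langle\Psi|)$, put $$I(\rho_A,\mathcal E)=H(\rho_R)+H(\rho_B)-H(\rho_{RB}),\qquad H(\rho)=-\mathrm{Tr}[\rho\log\rho],$$ where $\rho_R=\mathrm{Tr}_B\rho_{RB}$ and $\rho_B=\mathrm{Tr}_R\rho_{RB}$. **Theorem 2.** Let $\mathcal E$ be a quantum operation from $\mathcal H_A$ to $\mathcal H_B$ and let $\mathcal K_A\subseteq\mathcal H_A$ be a nonzero subspace. The number $I(\rho_A,\mathcal E)$ does not depend on the choice of the purification of $\rho_A\in\mathcal S(\mathcal H_A)$, and the following hold. 1. The following conditions are equivalent: (a) $\mathcal E$ is reversible with respect to $\mathcal S(\mathcal K_A)$; (b) $I(\rho_A,\mathcal E)=I(\rho_A,\mathcal I_A)$ for all $\rho_A\in\mathcal S(\mathcal K_A)$; (c) $I(\rho_A,\mathcal E)=I(\rho_A,\mathcal I_A)$ for some density operator $\rho_A$ whose support is exactly $\mathcal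 K_A$; (d) there is a quantum operation $\mathcal R$ from $\mathcal H_B$ to $\mathcal H_A$ such that $(\mathcal I_R\otimes\mathcal R\mathcal E)(|\Psi\rangle\langle\Psi|)=|\Psi\rangle\langle\Psi|$ for every purification $\Psi$ of every $\rho_A\in\mathcal S(\mathcal K_A)$; (e) there are a density operator $\rho_A$ whose support is exactly $\mathcal K_A$, a purification $\Psi$ of $\rho_A$ and a quantum operation $\mathcal R$ from $\mathcal H_B$ to $\mathcal H_A$ such that $(\mathcal I_R\otimes\mathcal R\mathcal E)(|\Psi\rangle\langle\Psi|)=|\Psi\rangle\langle\Psi|$. In particular, transmission of the subspace $\mathcal K_A$ (condition (a)) is equivalent to entanglement transmission (conditions (d) and (e)). 2. The following conditions are equivalent: (a) $\mathcal E$ is vanishing with respect to $\mathcal S(\mathcal K_A)$; (b) $I(\rho_A,\mathcal E)=0$ for all $\rho_A\in\mathcal S(\mathcal K_A)$; (c) $I(\rho_A,\mathcal E)=0$ for some density operator $\rho_A$ whose support is exactly $\mathcal K_A$. -/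

import Mathlib

universe u v

noncomputable section

/-! Finite-dimensional Hilbert spaces are written in an orthonormal basis: a finite index type `a`
stands for the Hilbert space `ℂ^a`, `Matrix a a ℂ` for the linear operators on it, and `r × a` for
the tensor product of `ℂ^r` and `ℂ^a`. -/

namespace QInfo

open Matrix
open scoped ComplexOrder

/-- Density operators: nonnegative (in particular self-adjoint) operators of trace one. -/
def IsDensity {a : Type u} [Fintype a] (ρ : Matrix a a ℂ) : Prop :=
  ρ.PosSemidef ∧ ρ.trace = 1

/-- The support of a self-adjoint operator, that is, its range. -/
def support {a : Type u} [Fintype a] (ρ : Matrix a a ℂ) : Submodule ℂ (a → ℂ) :=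
  LinearMap.range ρ.mulVecLin

/-- The set of density operators whose support is contained in the subspace `K`. -/
def statesOn {a : Type u} [Fintype a] (K : Submodule ℂ (a → ℂ)) : Set (Matrix a a ℂ) :=
  {ρ | IsDensity ρ ∧ support ρ ≤ K}

/-- The extension of the superoperator `E` by the identity superoperator of a reference system
`r`: the superoperator `E` is applied to each of the blocks of an operator on `ℂ^r ⊗ ℂ^a`. -/
def ampliation (r : Type*) {a : Type u} {b : Type v}
    (E : Matrix a a ℂ →ₗ[ℂ] Matrix b b ℂ) :
    Matrix (r × a) (r × a) ℂ →ₗ[ℂ] Matrix (r × b) (r × b) ℂ where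
  toFun X := Matrix.of fun p q =>
    E (Matrix.of fun k l => X (p.1, k) (q.1, l)) p.2 q.2
  map_add' X Y := by
    ext p q
    exact congrFun (congrFun (map_add E (Matrix.of fun k l => X (p.1, k) (q.1, l))
      (Matrix.of fun k l => Y (p.1, k) (q.1, l))) p.2) q.2
  map_smul' c X := by
    ext p q
    exact congrFun (congrFun (map_smul E c
      (Matrix.of fun k l => X (p.1, k) (q.1, l))) p.2) q.2

/-- Quantum operations: trace preserving and completely positive linear superoperators. -/
structure IsQuantumOperation {a : Type u} {b : Type v} [Fintype a] [Fintype b]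
    (E : Matrix a a ℂ →ₗ[ℂ] Matrix b b ℂ) : Prop where
  trace_preserving : ∀ X : Matrix a a ℂ, (E X).trace = X.trace
  completely_positive : ∀ (n : ℕ) (X : Matrix (Fin n × a) (Fin n × a) ℂ),
    X.PosSemidef → (ampliation (Fin n) E X).PosSemidef

/-- `E` is reversible with respect to the set `S` of states. -/
def Reversible {a : Type u} {b : Type v} [Fintype a] [Fintype b]
    (E : Matrix a a ℂ →ₗ[ℂ] Matrix b b ℂ) (S : Set (Matrix a a ℂ)) : Prop :=
  ∃ R : Matrix b b ℂ →ₗ[ℂ] Matrix a a ℂ, IsQuantumOperation R ∧ ∀ ρ ∈ S, R (E ρ) = ρ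

/-- `E` is vanishing with respect to the set `S` of states. -/
def Vanishing {a : Type u} {b : Type v} [Fintype b]
    (E : Matrix a a ℂ →ₗ[ℂ] Matrix b b ℂ) (S : Set (Matrix a a ℂ)) : Prop :=
  ∃ ρ₀ : Matrix b b ℂ, IsDensity ρ₀ ∧ ∀ ρ ∈ S, E ρ = ρ₀

/-- The partial trace over the second tensor factor. -/
def traceSnd {x : Type u} {y : Type v} [Fintype y]
    (ρ : Matrix (x × y) (x × y) ℂ) : Matrix x x ℂ :=
  Matrix.of fun i j => ∑ k, ρ (i, k) (j, k)

/-- The partial trace over the first tensor factor. -/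
def traceFst {x : Type u} {y : Type v} [Fintype x]
    (ρ : Matrix (x × y) (x × y) ℂ) : Matrix y y ℂ :=
  Matrix.of fun k l => ∑ i, ρ (i, k) (i, l)

/-- The von Neumann entropy `H(ρ) = -Tr[ρ log ρ]` (natural logarithm). -/
def entropy {x : Type*} [Fintype x] [DecidableEq x] (ρ : Matrix x x ℂ) : ℝ :=
  -(ρ * cfc Real.log ρ).trace.re

/-- The quantum mutual information `I(X;Y) = H(X) + H(Y) - H(XY)` of a bipartite state. -/
def mutualInfo {x : Type u} {y : Type v} [Fintype x] [DecidableEq x] [Fintype y] [DecidableEq y]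
    (ρ : Matrix (x × y) (x × y) ℂ) : ℝ :=
  entropy (traceSnd ρ) + entropy (traceFst ρ) - entropy ρ

/-- The rank-one operator `|Ψ⟩⟨Ψ|`. -/
def pureState {x : Type*} (Ψ : x → ℂ) : Matrix x x ℂ :=
  vecMulVec Ψ (star Ψ)

/-- `Ψ ∈ ℂ^r ⊗ ℂ^a` is a purification of `ρ` with reference system `ℂ^r`. -/
def IsPurification {r : Type*} {a : Type u} [Fintype r]
    (Ψ : r × a → ℂ) (ρ : Matrix a a ℂ) : Prop :=
  traceFst (pureState Ψ) = ρ

/-- The canonical purification `∑ i, e_i ⊗ √ρ e_i` of `ρ`, with a copy of `ℂ^a` as the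
reference system. -/
def canonicalPurification {a : Type u} [Fintype a] [DecidableEq a] (ρ : Matrix a a ℂ) :
    a × a → ℂ :=
  fun p => cfc Real.sqrt ρ p.2 p.1

/-- The canonical purification is a purification. -/
theorem isPurification_canonicalPurification {a : Type u} [Fintype a] [DecidableEq a]
    {ρ : Matrix a a ℂ} (hρ : ρ.PosSemidef) : IsPurification (canonicalPurification ρ) ρ := by
  have hs : (cfc Real.sqrt ρ)ᴴ = cfc Real.sqrt ρ := (cfc_predicate Real.sqrt ρ : IsSelfAdjoint _)
  have hm : cfc Real.sqrt ρ * cfc Real.sqrt ρ = ρ := by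
    rw [← cfc_mul Real.sqrt Real.sqrt ρ]
    have h1 : cfc (fun x : ℝ => Real.sqrt x * Real.sqrt x) ρ = cfc (fun x : ℝ => x) ρ := by
      apply cfc_congr
      intro x hx
      rw [hρ.1.spectrum_real_eq_range_eigenvalues] at hx
      obtain ⟨i, rfl⟩ := hx
      exact Real.mul_self_sqrt (hρ.eigenvalues_nonneg i)
    rw [h1]
    exact cfc_id' ℝ ρ hρ.1
  unfold IsPurification
  conv_rhs => rw [← hm]
  ext k l
  conv_rhs => rw [mul_apply]
  simp only [traceFst, pureState, canonicalPurification, of_apply, vecMulVec_apply, Pi.star_apply]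
  refine Finset.sum_congr rfl fun i _ => ?_
  rw [← conjTranspose_apply, hs]

/-- The mutual information `I(R;B)` of the state `ρ_RB = (I_R ⊗ E)(|Ψ⟩⟨Ψ|)`. -/
def purificationMutualInfo {r : Type*} {a : Type u} {b : Type v} [Fintype r] [DecidableEq r]
    [Fintype b] [DecidableEq b]
    (Ψ : r × a → ℂ) (E : Matrix a a ℂ →ₗ[ℂ] Matrix b b ℂ) : ℝ :=
  mutualInfo (ampliation r E (pureState Ψ))

/-- The mutual information `I(ρ, E)` of a state and a quantum operation. -/
def channelMutualInfo {a : Type u} {b : Type v} [Fintype a] [DecidableEq a]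
    [Fintype b] [DecidableEq b]
    (ρ : Matrix a a ℂ) (E : Matrix a a ℂ →ₗ[ℂ] Matrix b b ℂ) : ℝ :=
  purificationMutualInfo (canonicalPurification ρ) E

end QInfo

end

/-! Write `E` with Kraus operators `A i`; the outputs on the environment define the complementary
operation `krausMap (krausSwap A)`. The dilated purification is a pure state of reference, output
and environment, so entropies of complementary parts agree, and I(ρ, E) = H(ρ) + H(output) -
H(environment) (`purificationMutualInfo_krausMap`). This does not mention the purification.
Exchanging output and environment and adding gives 2 H(ρ) = I(ρ, id)
(`channelMutualInfo_add_krausSwap`). So `E` keeps all mutual information exactly when its complement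
has none.

Zero mutual information means a product state, by the equality case of Klein's inequality. On a
purification, that says that `E` agrees there with X ↦ Tr(X) σ. A linear map kills a purification of
a state with support K iff it kills every |x⟩⟨y| with x, y in K, iff it kills all states on K. This
gives the vanishing part and the equivalence with entanglement transmission.

Reversibility is then duality: a constant environment state provides an explicit recovery of
Knill–Laflamme type (`reversible_of_krausSwap_eq_diagonal`). Conversely, a recovery makes the
complement of the composition vanish, and tracing out the environment of the recovery leaves the
complement of `E`. -/

noncomputable section

namespace QInfo

open Matrix
open scoped ComplexOrder Kronecker

/-! ### Partial traces. -/

section PartialTrace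

variable {x y : Type*}

theorem trace_traceSnd [Fintype x] [Fintype y] (ρ : Matrix (x × y) (x × y) ℂ) :
    (traceSnd ρ).trace = ρ.trace := by
  simp [traceSnd, trace, Fintype.sum_prod_type]

theorem trace_traceFst [Fintype x] [Fintype y] (ρ : Matrix (x × y) (x × y) ℂ) :
    (traceFst ρ).trace = ρ.trace := by
  simp [traceFst, trace, Fintype.sum_prod_type_right]

theorem posSemidef_traceSnd [Fintype y] {ρ : Matrix (x × y) (x × y) ℂ} (h : ρ.PosSemidef) :
    (traceSnd ρ).PosSemidef := by
  have e : traceSnd ρ = ∑ k, ρ.submatrix (fun i => (i, k)) (fun i => (i, k)) := by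
    ext i j; simp [traceSnd, Matrix.sum_apply]
  rw [e]
  exact posSemidef_sum _ fun k _ => h.submatrix _

theorem posSemidef_traceFst [Fintype x] {ρ : Matrix (x × y) (x × y) ℂ} (h : ρ.PosSemidef) :
    (traceFst ρ).PosSemidef := posSemidef_traceSnd (h.submatrix Prod.swap)

theorem traceFst_eq_traceSnd_submatrix [Fintype x] (ρ : Matrix (x × y) (x × y) ℂ) :
    traceFst ρ = traceSnd (ρ.submatrix Prod.swap Prod.swap) := rfl

theorem traceSnd_kronecker [Fintype y] (σ : Matrix x x ℂ) {τ : Matrix y y ℂ} (h : τ.trace = 1) :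
    traceSnd (σ ⊗ₖ τ) = σ := by
  ext i j
  simp only [traceSnd, of_apply, kroneckerMap_apply, ← Finset.mul_sum]
  rw [show ∑ k, τ k k = 1 from h, mul_one]

theorem traceFst_kronecker [Fintype x] {σ : Matrix x x ℂ} (h : σ.trace = 1) (τ : Matrix y y ℂ) :
    traceFst (σ ⊗ₖ τ) = τ := by
  ext i j
  simp only [traceFst, of_apply, kroneckerMap_apply, ← Finset.sum_mul]
  rw [show ∑ k, σ k k = 1 from h, one_mul]

/-- A unitary change of basis on the traced factor is invisible. This allows passing to eigenbases
of both marginals at once. -/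
theorem traceSnd_conj_kronecker [Fintype x] [Fintype y] [DecidableEq y]
    (ρ : Matrix (x × y) (x × y) ℂ) (U : Matrix x x ℂ)
    {V : Matrix y y ℂ} (hV : V * Vᴴ = 1) :
    traceSnd ((U ⊗ₖ V)ᴴ * ρ * (U ⊗ₖ V)) = Uᴴ * traceSnd ρ * U := by
  have hV1 : ∀ k l, ∑ m, V k m * star (V l m) = if k = l then 1 else 0 := fun k l => by
    have := congrFun (congrFun hV k) l
    simpa [mul_apply, one_apply] using this
  ext i j
  simp only [traceSnd, of_apply, mul_apply, conjTranspose_apply, kroneckerMap_apply, star_mul',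
    Finset.sum_mul, Fintype.sum_prod_type, Finset.mul_sum]
  calc _ = ∑ j1, ∑ k1, ∑ i1, ∑ l1, star (U i1 i) * ρ (i1, l1) (j1, k1) * U j1 j *
        ∑ m, V k1 m * star (V l1 m) := by
        simp only [Finset.mul_sum]
        rw [Finset.sum_comm]
        refine Finset.sum_congr rfl fun j1 _ => ?_
        rw [Finset.sum_comm]
        refine Finset.sum_congr rfl fun k1 _ => ?_
        rw [Finset.sum_comm]
        refine Finset.sum_congr rfl fun i1 _ => ?_
        rw [Finset.sum_comm]
        refine Finset.sum_congr rfl fun l1 _ => ?_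
        refine Finset.sum_congr rfl fun m _ => ?_
        ring
    _ = _ := by
        simp only [hV1, mul_ite, mul_one, mul_zero, Finset.sum_ite_eq, Finset.mem_univ, if_true]
        refine Finset.sum_congr rfl fun j1 _ => ?_
        rw [Finset.sum_comm]

theorem traceFst_conj_kronecker [Fintype x] [DecidableEq x] [Fintype y]
    (ρ : Matrix (x × y) (x × y) ℂ) {U : Matrix x x ℂ}
    (hU : U * Uᴴ = 1) (V : Matrix y y ℂ) :
    traceFst ((U ⊗ₖ V)ᴴ * ρ * (U ⊗ₖ V)) = Vᴴ * traceFst ρ * V := by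
  rw [traceFst_eq_traceSnd_submatrix, traceFst_eq_traceSnd_submatrix,
    ← traceSnd_conj_kronecker _ V hU]
  congr 1
  have e : (V ⊗ₖ U) = (U ⊗ₖ V).submatrix (Equiv.prodComm y x) (Equiv.prodComm y x) := by
    ext i j; simp [mul_comm]
  have s : (Prod.swap : y × x → x × y) = Equiv.prodComm y x := rfl
  rw [e, s, conjTranspose_submatrix, submatrix_mul_equiv, submatrix_mul_equiv]

end PartialTrace

/-- The equality case of Klein's inequality, for eigenvalues and transition amplitudes. -/
theorem eq_zero_or_eq_of_sum_mul_log_le {x : Type*} [Fintype x] {p q : x → ℝ}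
    (hp : ∀ i, 0 ≤ p i) (hq : ∀ i, 0 ≤ q i)
    {w : x → x → ℝ} (hw : ∀ i j, 0 ≤ w i j) (hw1 : ∀ i, ∑ j, w i j = 1) (hw2 : ∀ j, ∑ i, w i j = 1)
    (hpq : ∑ i, p i = ∑ i, q i) (h0 : ∀ i j, q j = 0 → p i * w i j = 0)
    (hle : ∑ i, p i * Real.log (p i) ≤ ∑ i, ∑ j, p i * w i j * Real.log (q j)) (i j : x) :
    w i j = 0 ∨ p i = q j := by
  -- Subtracting `w (p - q)`, whose double sum is zero, makes every term nonnegative: it is `p w (t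
  -- - 1 - log t)` with `t = q / p`. Since `Real.log 0 = 0`, zeros of `p` and `q` are treated
  -- separately; if `q = 0` and `w > 0`, then `h0` forces `p = 0`.
  have key : ∀ i j, 0 ≤ p i * w i j * Real.log (p i) - p i * w i j * Real.log (q j)
      - w i j * (p i - q j) ∧ (p i * w i j * Real.log (p i) - p i * w i j * Real.log (q j)
      - w i j * (p i - q j) = 0 → w i j = 0 ∨ p i = q j) := by
    intro i j
    rcases (hw i j).eq_or_lt with h | hwp
    · simp [← h]
    rcases (hq j).eq_or_lt with hqz | hqp
    · have := h0 i j hqz.symm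
      rcases mul_eq_zero.1 this with h | h
      · simp [h, ← hqz]
      · exact absurd h hwp.ne'
    rcases (hp i).eq_or_lt with hpz | hpp
    · simp only [← hpz]
      constructor
      · have := mul_pos hwp hqp
        simp; linarith
      · intro h
        simp at h
        rcases h with h | h
        · exact Or.inl h
        · exact Or.inr h.symm
    have e : p i * w i j * Real.log (p i) - p i * w i j * Real.log (q j) - w i j * (p i - q j) =
        p i * w i j * (q j / p i - 1 - Real.log (q j / p i)) := by
      rw [Real.log_div hqp.ne' hpp.ne']
      field_simp
      ring
    rw [e]
    have hpos : 0 < q j / p i := div_pos hqp hpp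
    refine ⟨mul_nonneg (mul_pos hpp hwp).le ?_, fun h => Or.inr ?_⟩
    · linarith [Real.log_le_sub_one_of_pos hpos]
    · rcases mul_eq_zero.1 h with h | h
      · exact absurd h (mul_pos hpp hwp).ne'
      · by_contra hne
        have : q j / p i ≠ 1 := fun h' => hne ((div_eq_one_iff_eq hpp.ne').1 h').symm
        linarith [Real.log_lt_sub_one_of_pos hpos this]
  have hsum : ∑ i, ∑ j, (p i * w i j * Real.log (p i) - p i * w i j * Real.log (q j)
      - w i j * (p i - q j)) ≤ 0 := by
    have e1 : ∑ i, ∑ j, p i * w i j * Real.log (p i) = ∑ i, p i * Real.log (p i) := by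
      refine Finset.sum_congr rfl fun i _ => ?_
      rw [← Finset.sum_mul, ← Finset.mul_sum, hw1, mul_one]
    have e2 : ∑ i, ∑ j, w i j * (p i - q j) = 0 := by
      simp only [mul_sub, Finset.sum_sub_distrib]
      rw [Finset.sum_comm (f := fun i j => w i j * q j)]
      simp only [← Finset.sum_mul, hw1, hw2, one_mul, hpq, sub_self]
    simp only [Finset.sum_sub_distrib] at e2 ⊢
    rw [e1]
    linarith
  have hz := (Finset.sum_eq_zero_iff_of_nonneg fun i _ =>
    Finset.sum_nonneg fun j _ => (key i j).1).1
    (hsum.antisymm (Finset.sum_nonneg fun i _ => Finset.sum_nonneg fun j _ => (key i j).1))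
    i (Finset.mem_univ i)
  exact (key i j).2 ((Finset.sum_eq_zero_iff_of_nonneg fun j _ => (key i j).1).1 hz j
    (Finset.mem_univ j))

/-! ### Entropy, relative entropy and product states. -/

section Entropy

variable {x y : Type*} [Fintype x] [DecidableEq x] [Fintype y] [DecidableEq y]

theorem exists_unitary_diagonal {ρ : Matrix x x ℂ} (h : ρ.IsHermitian) :
    ∃ U : Matrix x x ℂ, Uᴴ * U = 1 ∧ U * Uᴴ = 1 ∧
      ρ = U * diagonal (fun i => (h.eigenvalues i : ℂ)) * Uᴴ := by
  refine ⟨h.eigenvectorUnitary, ?_, ?_, ?_⟩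
  · exact (Matrix.mem_unitaryGroup_iff').1 h.eigenvectorUnitary.2
  · exact (Matrix.mem_unitaryGroup_iff).1 h.eigenvectorUnitary.2
  · exact h.spectral_theorem

theorem entropy_eq_sum_eigenvalues {ρ : Matrix x x ℂ} (h : ρ.IsHermitian) :
    entropy ρ = ∑ i, Real.negMulLog (h.eigenvalues i) := by
  obtain hU := (Matrix.mem_unitaryGroup_iff').1 h.eigenvectorUnitary.2
  have h1 : ρ * cfc Real.log ρ = h.cfc (fun t => t * Real.log t) := by
    rw [← h.cfc_eq, cfc_mul (fun t : ℝ => t) Real.log ρ (by fun_prop)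
      ((finite_real_spectrum (A := ρ)).continuousOn _), cfc_id' ℝ ρ h.isSelfAdjoint]
  rw [entropy, h1, Matrix.IsHermitian.cfc, Unitary.conjStarAlgAut_apply, Matrix.trace_mul_cycle,
    hU, one_mul, trace_diagonal, Complex.re_sum, ← Finset.sum_neg_distrib]
  refine Finset.sum_congr rfl fun i _ => ?_
  simp [Real.negMulLog]

/-- The sum of `-t log t` over a multiset of eigenvalues. -/
def rootEntropy (s : Multiset ℂ) : ℝ := (s.map fun z => Real.negMulLog z.re).sum

theorem rootEntropy_add (s t : Multiset ℂ) :
    rootEntropy (s + t) = rootEntropy s + rootEntropy t := by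
  simp [rootEntropy]

theorem rootEntropy_roots_X_pow (n : ℕ) :
    rootEntropy (Polynomial.X ^ n : Polynomial ℂ).roots = 0 := by
  rw [rootEntropy, Polynomial.roots_pow, Polynomial.roots_X, Multiset.map_nsmul,
    Multiset.sum_nsmul]
  simp

/-- Entropy thus depends only on the characteristic polynomial, so operators can be compared without
matching their eigenbases. -/
theorem entropy_eq_rootEntropy {ρ : Matrix x x ℂ} (h : ρ.IsHermitian) :
    entropy ρ = rootEntropy ρ.charpoly.roots := by
  rw [entropy_eq_sum_eigenvalues h, h.roots_charpoly_eq_eigenvalues, rootEntropy, Multiset.map_map]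
  simp [Function.comp_def]

theorem entropy_transpose {ρ : Matrix x x ℂ} (h : ρ.IsHermitian) : entropy ρᵀ = entropy ρ := by
  rw [entropy_eq_rootEntropy h, entropy_eq_rootEntropy h.transpose, charpoly_transpose]

/-- The two characteristic polynomials agree up to powers of `X`, and zero eigenvalues contribute
nothing. For a pure state, with `M` its coefficient matrix, this is the equality of the entropies of
its two marginals. -/
theorem entropy_mul_conjTranspose (M : Matrix x y ℂ) : entropy (M * Mᴴ) = entropy (Mᴴ * M) := by
  rw [entropy_eq_rootEntropy (isHermitian_mul_conjTranspose_self M),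
    entropy_eq_rootEntropy (isHermitian_conjTranspose_mul_self M)]
  have h := congrArg (fun p => rootEntropy p.roots) (charpoly_mul_comm' M Mᴴ)
  rwa [Polynomial.roots_mul (mul_ne_zero (by simp) (charpoly_monic _).ne_zero),
    Polynomial.roots_mul (mul_ne_zero (by simp) (charpoly_monic _).ne_zero),
    rootEntropy_add, rootEntropy_add, rootEntropy_roots_X_pow, rootEntropy_roots_X_pow,
    zero_add, zero_add] at h

theorem isHermitian_unitary_diagonal (U : Matrix x x ℂ) (d : x → ℝ) :
    (U * diagonal (fun i => (d i : ℂ)) * Uᴴ).IsHermitian := by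
  refine isHermitian_mul_mul_conjTranspose U ?_
  simp [IsHermitian, diagonal_conjTranspose, Pi.star_def]

theorem entropy_unitary_diagonal {U : Matrix x x ℂ} (hU : Uᴴ * U = 1) (d : x → ℝ) :
    entropy (U * diagonal (fun i => (d i : ℂ)) * Uᴴ) = ∑ i, Real.negMulLog (d i) := by
  rw [entropy_eq_rootEntropy (isHermitian_unitary_diagonal U d), mul_assoc, charpoly_mul_comm,
    mul_assoc, hU, mul_one, charpoly_diagonal, Polynomial.roots_prod _ _
      (Finset.prod_ne_zero_iff.2 fun i _ => Polynomial.X_sub_C_ne_zero _)]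
  simp only [Polynomial.roots_X_sub_C, rootEntropy, Multiset.map_bind, Multiset.map_singleton,
    Complex.ofReal_re, Multiset.sum_bind, Multiset.sum_singleton]
  rfl

theorem sum_eigenvalues_eq_one {ρ : Matrix x x ℂ} (h : ρ.IsHermitian) (ht : ρ.trace = 1) :
    ∑ i, h.eigenvalues i = 1 := by
  have := h.trace_eq_sum_eigenvalues
  rw [ht] at this
  have h2 : ((∑ i, h.eigenvalues i : ℝ) : ℂ) = 1 := by rw [this, Complex.ofReal_sum]; rfl
  exact_mod_cast h2

theorem kronecker_unitary_diagonal (U : Matrix x x ℂ) (V : Matrix y y ℂ) (d : x → ℝ) (f : y → ℝ) :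
    (U * diagonal (fun i => (d i : ℂ)) * Uᴴ) ⊗ₖ (V * diagonal (fun i => (f i : ℂ)) * Vᴴ) =
      (U ⊗ₖ V) * diagonal (fun i : x × y => ((d i.1 * f i.2 : ℝ) : ℂ)) * (U ⊗ₖ V)ᴴ := by
  rw [conjTranspose_kronecker, mul_kronecker_mul, mul_kronecker_mul, diagonal_kronecker_diagonal]
  simp

/-- The entropy is additive on product states. -/
theorem entropy_kronecker {σ : Matrix x x ℂ} {τ : Matrix y y ℂ} (hσ : IsDensity σ)
    (hτ : IsDensity τ) : entropy (σ ⊗ₖ τ) = entropy σ + entropy τ := by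
  obtain ⟨U, hU, -, h1⟩ := exists_unitary_diagonal hσ.1.1
  obtain ⟨V, hV, -, h2⟩ := exists_unitary_diagonal hτ.1.1
  have hUV : (U ⊗ₖ V)ᴴ * (U ⊗ₖ V) = 1 := by
    rw [conjTranspose_kronecker, ← mul_kronecker_mul, hU, hV, one_kronecker_one]
  rw [entropy_eq_sum_eigenvalues hσ.1.1, entropy_eq_sum_eigenvalues hτ.1.1]
  conv_lhs => rw [h1, h2]
  rw [kronecker_unitary_diagonal, entropy_unitary_diagonal hUV, Fintype.sum_prod_type]
  simp only [Real.negMulLog_mul, Finset.sum_add_distrib, ← Finset.sum_mul, ← Finset.mul_sum,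
    sum_eigenvalues_eq_one hσ.1.1 hσ.2, sum_eigenvalues_eq_one hτ.1.1 hτ.2]
  simp

theorem sum_normSq_row {W : Matrix x x ℂ} (h : W * Wᴴ = 1) (i : x) :
    ∑ j, Complex.normSq (W i j) = 1 := by
  have := congrFun (congrFun h i) i
  simp only [mul_apply, conjTranspose_apply, one_apply_eq, Complex.star_def,
    Complex.mul_conj] at this
  exact_mod_cast this

theorem sum_normSq_col {W : Matrix x x ℂ} (h : Wᴴ * W = 1) (j : x) :
    ∑ i, Complex.normSq (W i j) = 1 := by
  have := congrFun (congrFun h j) j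
  simp only [mul_apply, conjTranspose_apply, one_apply_eq, Complex.star_def,
    mul_comm (starRingEnd ℂ _),
    Complex.mul_conj] at this
  exact_mod_cast this

theorem diag_conj_diagonal (W : Matrix x x ℂ) (d : x → ℝ) (j : x) :
    (Wᴴ * diagonal (fun i => (d i : ℂ)) * W) j j =
      ((∑ i, d i * Complex.normSq (W i j) : ℝ) : ℂ) := by
  rw [mul_apply]
  simp only [mul_diagonal, conjTranspose_apply, Complex.ofReal_sum, Complex.ofReal_mul]
  refine Finset.sum_congr rfl fun i _ => ?_
  rw [← Complex.mul_conj, Complex.star_def]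
  ring

/-- The equality case of Klein's inequality: if `ρ` has no weight outside of the support of `σ` and
the relative entropy of `ρ` with respect to `σ = V diag(q) V†` is not positive, then `ρ = σ`. -/
theorem eq_of_relative_entropy_le {ρ : Matrix x x ℂ} (hρ : IsDensity ρ) {V : Matrix x x ℂ}
    (hV : Vᴴ * V = 1) (hV' : V * Vᴴ = 1) {q : x → ℝ} (hq : ∀ j, 0 ≤ q j) (hq1 : ∑ j, q j = 1)
    (h0 : ∀ j, q j = 0 → (Vᴴ * ρ * V) j j = 0)
    (hle : -entropy ρ ≤ ∑ j, ((Vᴴ * ρ * V) j j).re * Real.log (q j)) :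
    ρ = V * diagonal (fun i => (q i : ℂ)) * Vᴴ := by
  obtain ⟨U, hU, hU', hρU⟩ := exists_unitary_diagonal hρ.1.1
  set p := hρ.1.1.eigenvalues with hpdef
  have hp : ∀ i, 0 ≤ p i := hρ.1.eigenvalues_nonneg
  -- The squared moduli of the entries of `W` form the doubly stochastic matrix relating the
  -- eigenvalues of `ρ` to its diagonal in the basis `V`.
  set W := Uᴴ * V with hW
  have hWc : Wᴴ = Vᴴ * U := by rw [hW, conjTranspose_mul, conjTranspose_conjTranspose]
  have hW1 : W * Wᴴ = 1 := by
    rw [hWc, hW, mul_assoc, ← mul_assoc V, hV', one_mul, hU]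
  have hW2 : Wᴴ * W = 1 := by
    rw [hWc, hW, mul_assoc, ← mul_assoc U, hU', one_mul, hV]
  have hc : Vᴴ * ρ * V = Wᴴ * diagonal (fun i => (p i : ℂ)) * W := by
    rw [hWc, hW]; conv_lhs => rw [hρU]
    simp only [mul_assoc]
  have hd : ∀ j, (Vᴴ * ρ * V) j j = ((∑ i, p i * Complex.normSq (W i j) : ℝ) : ℂ) := fun j => by
    rw [hc, diag_conj_diagonal]
  have hall := eq_zero_or_eq_of_sum_mul_log_le hp hq (w := fun i j => Complex.normSq (W i j))
    (fun _ _ => Complex.normSq_nonneg _) (sum_normSq_row hW1) (sum_normSq_col hW2)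
    (by rw [sum_eigenvalues_eq_one hρ.1.1 hρ.2, hq1])
    (by
      intro i j hj
      have := h0 j hj
      rw [hd, Complex.ofReal_eq_zero] at this
      exact (Finset.sum_eq_zero_iff_of_nonneg fun i _ =>
        mul_nonneg (hp i) (Complex.normSq_nonneg _)).1 this i (Finset.mem_univ i))
    (by
      rw [entropy_eq_sum_eigenvalues hρ.1.1, ← Finset.sum_neg_distrib] at hle
      simp only [Real.negMulLog, neg_mul, neg_neg] at hle
      refine hle.trans (le_of_eq ?_)
      rw [Finset.sum_comm]
      refine Finset.sum_congr rfl fun j _ => ?_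
      rw [hd, Complex.ofReal_re, Finset.sum_mul])
  -- Each entry of `W` is zero or joins equal eigenvalues, so `W` intertwines the two diagonal
  -- matrices.
  have hcomm : diagonal (fun i => (p i : ℂ)) * W = W * diagonal (fun i => (q i : ℂ)) := by
    ext i j
    rw [diagonal_mul, mul_diagonal]
    rcases hall i j with h | h
    · simp [Complex.normSq_eq_zero.1 h]
    · rw [h, mul_comm]
  have hVW : V = U * W := by rw [hW, ← mul_assoc, hU', one_mul]
  have hV2 : V * diagonal (fun i => (q i : ℂ)) = U * diagonal (fun i => (p i : ℂ)) * W := by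
    rw [hVW, mul_assoc, ← hcomm, mul_assoc]
  rw [hV2, mul_assoc _ W, hW, mul_assoc Uᴴ, hV', mul_one]
  exact hρU

/-- A state without mutual information is a product state. -/
theorem eq_kronecker_of_mutualInfo_eq_zero {ρ : Matrix (x × y) (x × y) ℂ} (hρ : IsDensity ρ)
    (h : mutualInfo ρ = 0) : ρ = traceSnd ρ ⊗ₖ traceFst ρ := by
  have hS : IsDensity (traceSnd ρ) := ⟨posSemidef_traceSnd hρ.1, (trace_traceSnd ρ).trans hρ.2⟩
  have hF : IsDensity (traceFst ρ) := ⟨posSemidef_traceFst hρ.1, (trace_traceFst ρ).trans hρ.2⟩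
  obtain ⟨U, hU, hU', h1⟩ := exists_unitary_diagonal hS.1.1
  obtain ⟨V, hV, hV', h2⟩ := exists_unitary_diagonal hF.1.1
  set d := hS.1.1.eigenvalues
  set f := hF.1.1.eigenvalues
  have hd : ∀ i, 0 ≤ d i := hS.1.eigenvalues_nonneg
  have hf : ∀ i, 0 ≤ f i := hF.1.eigenvalues_nonneg
  have hd1 : ∑ i, d i = 1 := sum_eigenvalues_eq_one _ hS.2
  have hf1 : ∑ i, f i = 1 := sum_eigenvalues_eq_one _ hF.2
  have hUV : (U ⊗ₖ V)ᴴ * (U ⊗ₖ V) = 1 := by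
    rw [conjTranspose_kronecker, ← mul_kronecker_mul, hU, hV, one_kronecker_one]
  have hUV' : (U ⊗ₖ V) * (U ⊗ₖ V)ᴴ = 1 := by
    rw [conjTranspose_kronecker, ← mul_kronecker_mul, hU', hV', one_kronecker_one]
  -- In the product of the eigenbases, the diagonal of `τ` is a joint distribution with marginals
  -- `d` and `f`.
  set τ := (U ⊗ₖ V)ᴴ * ρ * (U ⊗ₖ V) with hτ
  have hτp : τ.PosSemidef := hρ.1.conjTranspose_mul_mul_same _
  have hm1 : ∀ i, ∑ k, τ (i, k) (i, k) = d i := by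
    intro i
    have e : traceSnd τ = diagonal (fun i => (d i : ℂ)) := by
      rw [hτ, traceSnd_conj_kronecker _ _ hV', h1]
      simp only [mul_assoc, hU, mul_one]
      rw [← mul_assoc, hU, one_mul]
    have := congrFun (congrFun e i) i
    simpa [traceSnd] using this
  have hm2 : ∀ k, ∑ i, τ (i, k) (i, k) = f k := by
    intro k
    have e : traceFst τ = diagonal (fun i => (f i : ℂ)) := by
      rw [hτ, traceFst_conj_kronecker _ hU', h2]
      simp only [mul_assoc, hV, mul_one]
      rw [← mul_assoc, hV, one_mul]
    have := congrFun (congrFun e k) k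
    simpa [traceFst] using this
  have hnn : ∀ j, 0 ≤ τ j j := fun j => hτp.diag_nonneg
  have hr1 : ∀ i, ∑ k, (τ (i, k) (i, k)).re = d i := fun i => by
    rw [← Complex.re_sum, hm1, Complex.ofReal_re]
  have hr2 : ∀ k, ∑ i, (τ (i, k) (i, k)).re = f k := fun k => by
    rw [← Complex.re_sum, hm2, Complex.ofReal_re]
  have hd0 : ∀ i k, d i = 0 → τ (i, k) (i, k) = 0 := fun i k hi => by
    have := hm1 i
    rw [hi, Complex.ofReal_zero, Finset.sum_eq_zero_iff_of_nonneg fun k _ => hnn _] at this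
    exact this k (Finset.mem_univ k)
  have hf0 : ∀ i k, f k = 0 → τ (i, k) (i, k) = 0 := fun i k hi => by
    have := hm2 k
    rw [hi, Complex.ofReal_zero, Finset.sum_eq_zero_iff_of_nonneg fun k _ => hnn _] at this
    exact this i (Finset.mem_univ i)
  conv_rhs => rw [h1, h2]
  rw [kronecker_unitary_diagonal]
  refine eq_of_relative_entropy_le hρ hUV hUV' (fun j => mul_nonneg (hd _) (hf _)) ?_ ?_ ?_
  · simp [Fintype.sum_prod_type, ← Finset.mul_sum, hd1, hf1]
  · rintro ⟨i, k⟩ hik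
    rcases mul_eq_zero.1 hik with h | h
    · exact hd0 i k h
    · exact hf0 i k h
  -- The mutual information is the relative entropy of `ρ` with respect to the product of its
  -- marginals.
  · have e : -entropy ρ = -(entropy (traceSnd ρ) + entropy (traceFst ρ)) := by
      rw [mutualInfo] at h; linarith
    rw [e, entropy_eq_sum_eigenvalues hS.1.1, entropy_eq_sum_eigenvalues hF.1.1]
    refine le_of_eq ?_
    -- The logarithm of the product splits where both factors are nonzero; elsewhere the weight `τ j
    -- j` is zero.
    have e1 : ∀ j : x × y, (τ j j).re * Real.log (d j.1 * f j.2) =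
        (τ j j).re * Real.log (d j.1) + (τ j j).re * Real.log (f j.2) := by
      rintro ⟨i, k⟩
      by_cases hi : d i = 0
      · simp [hd0 i k hi]
      by_cases hk : f k = 0
      · simp [hf0 i k hk]
      rw [Real.log_mul hi hk, mul_add]
    rw [Finset.sum_congr rfl fun j _ => e1 j, Finset.sum_add_distrib, Fintype.sum_prod_type,
      Fintype.sum_prod_type_right]
    simp only [← Finset.sum_mul, hr1, hr2, Real.negMulLog, neg_mul, Finset.sum_neg_distrib]
    simp only [d, f]
    ring

theorem mutualInfo_kronecker {σ : Matrix x x ℂ} {τ : Matrix y y ℂ} (hσ : IsDensity σ)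
    (hτ : IsDensity τ) : mutualInfo (σ ⊗ₖ τ) = 0 := by
  rw [mutualInfo, traceSnd_kronecker σ hτ.2, traceFst_kronecker hσ.2 τ, entropy_kronecker hσ hτ,
    sub_self]

end Entropy

/-! ### Kraus operators and complementary operations. -/

section Kraus

variable {a b c e f r : Type*}

/-- The Kraus operators of the complementary operation: the environment and the output are
exchanged. -/
def krausSwap (A : e → Matrix b a ℂ) : b → Matrix e a ℂ := fun k => of fun i l => A i k l

variable [Fintype a]

/-- The superoperator `X ↦ ∑ i, A i * X * (A i)ᴴ` with the Kraus operators `A i`. -/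
def krausMap [Fintype e] (A : e → Matrix b a ℂ) : Matrix a a ℂ →ₗ[ℂ] Matrix b b ℂ where
  toFun X := ∑ i, A i * X * (A i)ᴴ
  map_add' X Y := by simp [Matrix.mul_add, Matrix.add_mul, Finset.sum_add_distrib]
  map_smul' c X := by simp [Finset.smul_sum]

theorem krausMap_apply [Fintype e] (A : e → Matrix b a ℂ) (X : Matrix a a ℂ) :
    krausMap A X = ∑ i, A i * X * (A i)ᴴ := rfl

theorem krausMap_apply_apply [Fintype e] (A : e → Matrix b a ℂ) (X : Matrix a a ℂ) (k k' : b) :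
    krausMap A X k k' = ∑ i, ∑ m, ∑ l, A i k l * X l m * star (A i k' m) := by
  simp [krausMap_apply, Matrix.sum_apply, mul_apply, Finset.sum_mul]

theorem posSemidef_krausMap [Fintype e] [Finite b] (A : e → Matrix b a ℂ) {X : Matrix a a ℂ}
    (hX : X.PosSemidef) : (krausMap A X).PosSemidef :=
  posSemidef_sum _ fun i _ => hX.mul_mul_conjTranspose_same (A i)

theorem trace_krausMap [Fintype e] [Fintype b] (A : e → Matrix b a ℂ) (X : Matrix a a ℂ) :
    (krausMap A X).trace = ((∑ i, (A i)ᴴ * A i) * X).trace := by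
  rw [krausMap_apply, trace_sum, Matrix.sum_mul, trace_sum]
  exact Finset.sum_congr rfl fun i _ => by rw [trace_mul_cycle]

theorem trace_krausMap_krausSwap [Fintype e] [Fintype b] (A : e → Matrix b a ℂ)
    (X : Matrix a a ℂ) : (krausMap (krausSwap A) X).trace = (krausMap A X).trace := by
  simp only [trace, diag_apply, krausMap_apply_apply, krausSwap, of_apply]
  exact Finset.sum_comm

theorem krausMap_comp [Fintype b] [Fintype e] [Fintype f] (B : f → Matrix c b ℂ)
    (A : e → Matrix b a ℂ) (X : Matrix a a ℂ) :
    krausMap B (krausMap A X) = krausMap (fun p : f × e => B p.1 * A p.2) X := by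
  simp only [krausMap_apply, Fintype.sum_prod_type, Matrix.mul_sum, Matrix.sum_mul,
    conjTranspose_mul, Matrix.mul_assoc]

theorem krausMap_krausSwap_apply [Fintype b] (A : e → Matrix b a ℂ) (X : Matrix a a ℂ) (i j : e) :
    krausMap (krausSwap A) X i j = (A i * X * (A j)ᴴ).trace := by
  rw [krausMap_apply_apply]
  simp [krausSwap, trace, mul_apply, Finset.sum_mul]

/-- Tracing out the environment of `B` in the complement of a composition gives the complement of
`A`, if `B` is trace preserving. -/
theorem traceFst_krausMap_krausSwap_comp [Fintype b] [Fintype c] [Fintype e] [Fintype f]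
    [DecidableEq b] {B : f → Matrix c b ℂ} (hB : ∑ j, (B j)ᴴ * B j = 1) (A : e → Matrix b a ℂ)
    (X : Matrix a a ℂ) :
    traceFst (krausMap (krausSwap fun p : f × e => B p.1 * A p.2) X) =
      krausMap (krausSwap A) X := by
  ext i i'
  simp only [traceFst, of_apply, krausMap_krausSwap_apply]
  rw [show A i * X * (A i')ᴴ = (∑ j, (B j)ᴴ * B j) * A i * X * (A i')ᴴ by rw [hB, Matrix.one_mul],
    Matrix.sum_mul, Matrix.sum_mul, Matrix.sum_mul, trace_sum]
  refine Finset.sum_congr rfl fun j _ => ?_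
  rw [conjTranspose_mul, ← Matrix.mul_assoc, trace_mul_comm]
  simp only [Matrix.mul_assoc]

theorem ampliation_krausMap [Fintype e] [Fintype r] [DecidableEq r] (A : e → Matrix b a ℂ)
    (X : Matrix (r × a) (r × a) ℂ) :
    ampliation r (krausMap A) X = krausMap (fun i => (1 : Matrix r r ℂ) ⊗ₖ A i) X := by
  ext ⟨p, k⟩ ⟨q, k'⟩
  rw [krausMap_apply_apply]
  change krausMap A _ k k' = _
  rw [krausMap_apply_apply]
  refine Finset.sum_congr rfl fun i _ => ?_
  simp only [Fintype.sum_prod_type, kroneckerMap_apply, one_apply, ite_mul, one_mul, zero_mul,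
    of_apply, apply_ite star, star_zero, mul_ite, mul_zero]
  rw [Finset.sum_eq_single q (fun s _ hs => Finset.sum_eq_zero fun m _ =>
    Finset.sum_eq_zero fun s' _ => Finset.sum_eq_zero fun l _ => if_neg hs.symm) (by simp)]
  refine Finset.sum_congr rfl fun m _ => ?_
  rw [Finset.sum_eq_single p (fun s _ hs => Finset.sum_eq_zero fun l _ => by simp [hs.symm])
    (by simp)]
  simp

theorem isQuantumOperation_krausMap {a : Type u} {b : Type v} [Fintype a] [DecidableEq a]
    [Fintype b] [Fintype e]
    {A : e → Matrix b a ℂ} (hA : ∑ i, (A i)ᴴ * A i = 1) : IsQuantumOperation (krausMap A) where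
  trace_preserving X := by rw [trace_krausMap, hA, one_mul]
  completely_positive n X hX := by
    rw [ampliation_krausMap]
    exact posSemidef_krausMap _ hX

theorem posSemidef_pureState (Ψ : a → ℂ) : (pureState Ψ).PosSemidef :=
  posSemidef_vecMulVec_self_star Ψ

/-- Quantum operations have Kraus operators. -/
theorem IsQuantumOperation.exists_krausMap {a : Type u} {b : Type v} [Fintype a] [DecidableEq a]
    [Fintype b] {E : Matrix a a ℂ →ₗ[ℂ] Matrix b b ℂ} (hE : IsQuantumOperation E) :
    ∃ (n : ℕ) (A : Fin n → Matrix b a ℂ), E = krausMap A ∧ ∑ i, (A i)ᴴ * A i = 1 := by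
  let g := Fintype.equivFin a
  -- The Choi matrix: `E` acts on half of an unnormalised maximally entangled vector. Complete
  -- positivity refers to `Fin n`, hence the relabelling by `g`. The vectors of a rank-one
  -- decomposition, reshaped into matrices, are the Kraus operators.
  have h1 := (hE.completely_positive _ _ (posSemidef_pureState
    (fun p : Fin (Fintype.card a) × a => if g p.2 = p.1 then (1 : ℂ) else 0))).submatrix
      (fun p : a × b => (g p.1, p.2))
  obtain ⟨n, w, hw⟩ := Matrix.posSemidef_iff_eq_sum_vecMulVec.1 h1
  have hC : ∀ l k m k', E (single l m 1) k k' = ∑ i, w i (l, k) * star (w i (m, k')) := by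
    intro l k m k'
    have h2 := congrFun (congrFun hw (l, k)) (m, k')
    simp only [Matrix.sum_apply, vecMulVec_apply, Pi.star_apply] at h2
    rw [← h2]
    change E _ k k' = E _ k k'
    refine congrFun (congrFun (congrArg E ?_) k) k'
    ext l' m'
    simp only [pureState, vecMulVec_apply, of_apply, Pi.star_apply, single_apply,
      EmbeddingLike.apply_eq_iff_eq]
    simp only [eq_comm (a := l) (b := l'), eq_comm (a := m) (b := m')]
    by_cases h : l' = l <;> by_cases h' : m' = m <;> simp [h, h']
  have hEA : E = krausMap fun i => of fun k l => w i (l, k) := by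
    ext X k k'
    rw [krausMap_apply_apply]
    conv_lhs => rw [matrix_eq_sum_single X]
    simp only [map_sum, Matrix.sum_apply, of_apply]
    have h3 : ∀ l m, E (single l m (X l m)) k k' =
        ∑ i, w i (l, k) * X l m * star (w i (m, k')) := by
      intro l m
      rw [show single l m (X l m) = X l m • single l m (1 : ℂ) by simp, map_smul, Matrix.smul_apply,
        hC, smul_eq_mul, Finset.mul_sum]
      exact Finset.sum_congr rfl fun i _ => by ring
    simp only [h3]
    rw [Finset.sum_comm]
    conv_rhs => rw [Finset.sum_comm]
    refine Finset.sum_congr rfl fun m _ => ?_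
    rw [Finset.sum_comm]
  refine ⟨n, _, hEA, ext_iff_trace_mul_right.2 fun X => ?_⟩
  rw [← trace_krausMap, ← hEA, one_mul, hE.trace_preserving]

end Kraus

/-! ### Maps that vanish on a subspace, on its states and on purifications. -/

section Agreement

variable {a c r : Type*} [Fintype a]

theorem support_mul_conjTranspose [Fintype r] (N : Matrix a r ℂ) :
    support (N * Nᴴ) = Submodule.span ℂ (Set.range N.col) := by
  rw [support, ← range_mulVecLin]
  refine Submodule.eq_of_le_of_finrank_eq ?_ (rank_self_mul_conjTranspose N)
  rw [mulVecLin_mul]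
  exact LinearMap.range_comp_le_range _ _

/-- The coordinates of a vector of `ℂ^r ⊗ ℂ^a` in `ℂ^a`, as the columns of a matrix. -/
def vecMatrix (Ψ : r × a → ℂ) : Matrix a r ℂ := of fun l p => Ψ (p, l)

omit [Fintype a] in
theorem traceFst_pureState [Fintype r] (Ψ : r × a → ℂ) :
    traceFst (pureState Ψ) = vecMatrix Ψ * (vecMatrix Ψ)ᴴ := by
  ext l m
  simp [traceFst, pureState, vecMatrix, mul_apply, vecMulVec_apply]

theorem traceSnd_pureState (Ψ : r × a → ℂ) :
    traceSnd (pureState Ψ) = ((vecMatrix Ψ)ᴴ * vecMatrix Ψ)ᵀ := by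
  ext l m
  simp [traceSnd, pureState, vecMatrix, mul_apply, vecMulVec_apply, mul_comm]

theorem IsPurification.support_eq [Fintype r] {Ψ : r × a → ℂ} {ρ : Matrix a a ℂ}
    (h : IsPurification Ψ ρ) : support ρ = Submodule.span ℂ (Set.range (vecMatrix Ψ).col) := by
  rw [← support_mul_conjTranspose, ← traceFst_pureState, h]

omit [Fintype a] in
theorem ampliation_pureState_apply (L : Matrix a a ℂ →ₗ[ℂ] Matrix c c ℂ) (Ψ : r × a → ℂ)
    (p q : r) (k k' : c) : ampliation r L (pureState Ψ) (p, k) (q, k') =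
      L (vecMulVec ((vecMatrix Ψ).col p) (star ((vecMatrix Ψ).col q))) k k' := rfl

/-- The blocks of the extended output are the images of |ψ_p⟩⟨ψ_q|, where the columns ψ_p of
`vecMatrix Ψ` lie in the support of `ρ`. Later `L` is a difference of two operations that are to
agree on `K`. -/
theorem IsPurification.ampliation_eq_zero [Fintype r] {L : Matrix a a ℂ →ₗ[ℂ] Matrix c c ℂ}
    {K : Submodule ℂ (a → ℂ)} (hL : ∀ x ∈ K, ∀ y ∈ K, L (vecMulVec x (star y)) = 0)
    {Ψ : r × a → ℂ} {ρ : Matrix a a ℂ} (h : IsPurification Ψ ρ) (hK : support ρ ≤ K) :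
    ampliation r L (pureState Ψ) = 0 := by
  have hm : ∀ p, (vecMatrix Ψ).col p ∈ K := fun p =>
    hK (h.support_eq ▸ Submodule.subset_span ⟨p, rfl⟩)
  ext ⟨p, k⟩ ⟨q, k'⟩
  rw [ampliation_pureState_apply, hL _ (hm p) _ (hm q)]
  rfl

/-- The columns of `vecMatrix Ψ` span the support, and the claim is sesquilinear in the two vectors.
-/
theorem IsPurification.eq_zero_of_ampliation_eq_zero [Fintype r]
    {L : Matrix a a ℂ →ₗ[ℂ] Matrix c c ℂ} {Ψ : r × a → ℂ} {ρ : Matrix a a ℂ}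
    (h : IsPurification Ψ ρ) (h0 : ampliation r L (pureState Ψ) = 0) :
    ∀ x ∈ support ρ, ∀ y ∈ support ρ, L (vecMulVec x (star y)) = 0 := by
  rw [h.support_eq]
  intro x hx y hy
  induction hx using Submodule.span_induction with
  | zero => simp
  | add x x' _ _ hx hx' => rw [add_vecMulVec, map_add, hx, hx', add_zero]
  | smul t x _ hx => rw [smul_vecMulVec, map_smul, hx, smul_zero]
  | mem x hx =>
    obtain ⟨p, rfl⟩ := hx
    induction hy using Submodule.span_induction with
    | zero => simp
    | add y y' _ _ hy hy' => rw [star_add, vecMulVec_add, map_add, hy, hy', add_zero]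
    | smul t y _ hy => rw [star_smul, vecMulVec_smul, map_smul, hy, smul_zero]
    | mem y hy =>
      obtain ⟨q, rfl⟩ := hy
      ext k k'
      rw [← ampliation_pureState_apply, h0]
      rfl

theorem eq_zero_of_mem_statesOn {L : Matrix a a ℂ →ₗ[ℂ] Matrix c c ℂ} {K : Submodule ℂ (a → ℂ)}
    (hL : ∀ x ∈ K, ∀ y ∈ K, L (vecMulVec x (star y)) = 0) {ρ : Matrix a a ℂ}
    (hρ : ρ ∈ statesOn K) : L ρ = 0 := by
  classical
  have h := isPurification_canonicalPurification hρ.1.1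
  have hm : ∀ p, (vecMatrix (canonicalPurification ρ)).col p ∈ K := fun p =>
    hρ.2 (h.support_eq ▸ Submodule.subset_span ⟨p, rfl⟩)
  have e : ρ = ∑ p, vecMulVec ((vecMatrix (canonicalPurification ρ)).col p)
      (star ((vecMatrix (canonicalPurification ρ)).col p)) := by
    conv_lhs => rw [← h]
    ext l m
    simp only [traceFst, pureState, of_apply, Matrix.sum_apply]
    rfl
  rw [e, map_sum]
  exact Finset.sum_eq_zero fun p _ => hL _ (hm p) _ (hm p)

theorem eq_zero_of_forall_mem_statesOn {L : Matrix a a ℂ →ₗ[ℂ] Matrix c c ℂ}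
    {K : Submodule ℂ (a → ℂ)} (hL : ∀ ρ ∈ statesOn K, L ρ = 0) :
    ∀ x ∈ K, ∀ y ∈ K, L (vecMulVec x (star y)) = 0 := by
  have h1 : ∀ x ∈ K, L (vecMulVec x (star x)) = 0 := by
    intro x hx
    rcases eq_or_ne x 0 with rfl | hx0
    · simp
    have hpos : 0 < x ⬝ᵥ star x := dotProduct_self_star_pos_iff.2 hx0
    have hmem : (x ⬝ᵥ star x)⁻¹ • vecMulVec x (star x) ∈ statesOn K := by
      refine ⟨⟨(posSemidef_vecMulVec_self_star x).smul (inv_nonneg.2 hpos.le), ?_⟩, ?_⟩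
      · rw [trace_smul, trace_vecMulVec, smul_eq_mul, inv_mul_cancel₀ hpos.ne']
      · rintro _ ⟨y, rfl⟩
        rw [mulVecLin_apply, smul_mulVec, vecMulVec_mulVec]
        exact K.smul_mem _ (by simpa using K.smul_mem _ hx)
    have := hL _ hmem
    rw [map_smul] at this
    exact (smul_eq_zero.1 this).resolve_left (inv_ne_zero hpos.ne')
  intro x hx y hy
  -- Polarisation: `x + y` gives the symmetric combination of the two cross terms, `x + I • y` the
  -- antisymmetric one.
  have h2 := h1 (x + y) (K.add_mem hx hy)
  have h3 := h1 (x + Complex.I • y) (K.add_mem hx (K.smul_mem _ hy))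
  simp only [star_add, add_vecMulVec, vecMulVec_add, map_add, h1 x hx, h1 y hy, star_smul,
    smul_vecMulVec, vecMulVec_smul, map_smul, Complex.star_def, Complex.conj_I, zero_add, add_zero,
    smul_zero] at h2 h3
  have h4 : L (vecMulVec y (star x)) = - L (vecMulVec x (star y)) := by
    rw [eq_neg_iff_add_eq_zero, ← h2, add_comm]
  rw [h4, smul_neg, neg_smul, ← neg_add, ← add_smul, neg_eq_zero] at h3
  exact (smul_eq_zero.1 h3).resolve_left (by simp)

end Agreement

/-! ### Mutual information through the dilation. -/

section MutualInformation

variable {a b e r : Type*}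

theorem traceFst_ampliation [Fintype r] (L : Matrix a a ℂ →ₗ[ℂ] Matrix b b ℂ)
    (X : Matrix (r × a) (r × a) ℂ) : traceFst (ampliation r L X) = L (traceFst X) := by
  have h : traceFst X = ∑ p, of fun k l => X (p, k) (p, l) := by
    ext k l; simp [traceFst, Matrix.sum_apply]
  ext k l
  rw [h, map_sum, Matrix.sum_apply]
  rfl

theorem traceSnd_ampliation [Fintype a] [Fintype b] {L : Matrix a a ℂ →ₗ[ℂ] Matrix b b ℂ}
    (hL : ∀ X, (L X).trace = X.trace) (X : Matrix (r × a) (r × a) ℂ) :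
    traceSnd (ampliation r L X) = traceSnd X := by
  ext p q
  exact hL (of fun k l => X (p, k) (q, l))

/-- The constant operation X ↦ Tr(X) σ yields product states; vanishing means agreeing with such a
map on `K`. -/
theorem ampliation_traceLinearMap_smulRight [Fintype a] (σ : Matrix b b ℂ)
    (X : Matrix (r × a) (r × a) ℂ) :
    ampliation r ((traceLinearMap a ℂ ℂ).smulRight σ) X = traceSnd X ⊗ₖ σ := by
  ext ⟨p, k⟩ ⟨q, k'⟩
  rfl

theorem ampliation_sub (L L' : Matrix a a ℂ →ₗ[ℂ] Matrix b b ℂ) (X : Matrix (r × a) (r × a) ℂ) :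
    ampliation r (L - L') X = ampliation r L X - ampliation r L' X := rfl

theorem IsDensity.krausMap [Fintype a] [Fintype b] [Fintype e] {A : e → Matrix b a ℂ}
    (hA : ∀ X, (krausMap A X).trace = X.trace) {ρ : Matrix a a ℂ} (hρ : IsDensity ρ) :
    IsDensity (krausMap A ρ) :=
  ⟨posSemidef_krausMap A hρ.1, (hA ρ).trans hρ.2⟩

variable [Fintype r] [Fintype a]

/-- The vector obtained from `Ψ` by the dilation of `krausMap A`, as an operator from the
environment to the reference and the output. -/
def dilatedMatrix (A : e → Matrix b a ℂ) (Ψ : r × a → ℂ) : Matrix (r × b) e ℂ :=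
  of fun q i => (A i * vecMatrix Ψ) q.2 q.1

omit [Fintype r] in
theorem ampliation_krausMap_pureState [Fintype e] (A : e → Matrix b a ℂ) (Ψ : r × a → ℂ) :
    ampliation r (krausMap A) (pureState Ψ) = dilatedMatrix A Ψ * (dilatedMatrix A Ψ)ᴴ := by
  ext ⟨p, k⟩ ⟨q, k'⟩
  rw [ampliation_pureState_apply, krausMap_apply, Matrix.sum_apply, mul_apply]
  refine Finset.sum_congr rfl fun i _ => ?_
  rw [mul_vecMulVec, vecMulVec_mul, ← star_mulVec]
  rfl

/-- Together with `ampliation_krausMap_pureState`: the states of the environment and of reference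
plus output are the two marginals of one pure state, so their entropies agree. -/
theorem krausMap_krausSwap_eq_transpose [Fintype b] (A : e → Matrix b a ℂ) (Ψ : r × a → ℂ) :
    krausMap (krausSwap A) (traceFst (pureState Ψ)) =
      ((dilatedMatrix A Ψ)ᴴ * dilatedMatrix A Ψ)ᵀ := by
  ext i j
  rw [krausMap_krausSwap_apply, traceFst_pureState, ← Matrix.mul_assoc, Matrix.mul_assoc _ _ (A j)ᴴ,
    ← conjTranspose_mul, transpose_apply, mul_apply, Fintype.sum_prod_type_right]
  simp only [trace, diag_apply]
  refine Finset.sum_congr rfl fun k _ => ?_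
  rw [mul_apply]
  exact Finset.sum_congr rfl fun p _ => mul_comm _ _

variable [DecidableEq a] [Fintype b] [DecidableEq b] [Fintype e] [DecidableEq e] [DecidableEq r]

/-- The mutual information in terms of the entropies of the input, of the output and of the
environment. -/
theorem purificationMutualInfo_krausMap {A : e → Matrix b a ℂ}
    (hA : ∀ X, (krausMap A X).trace = X.trace) {Ψ : r × a → ℂ} {ρ : Matrix a a ℂ}
    (h : IsPurification Ψ ρ) :
    purificationMutualInfo Ψ (krausMap A) =
      entropy ρ + entropy (krausMap A ρ) - entropy (krausMap (krausSwap A) ρ) := by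
  have h1 : entropy (traceSnd (pureState Ψ)) = entropy ρ := by
    rw [traceSnd_pureState, entropy_transpose (isHermitian_conjTranspose_mul_self _),
      ← entropy_mul_conjTranspose, ← traceFst_pureState, h]
  have h2 : entropy (krausMap (krausSwap A) ρ) =
      entropy (ampliation r (krausMap A) (pureState Ψ)) := by
    rw [← h, krausMap_krausSwap_eq_transpose,
      entropy_transpose (isHermitian_conjTranspose_mul_self _), ampliation_krausMap_pureState,
      entropy_mul_conjTranspose]
  rw [purificationMutualInfo, mutualInfo, traceSnd_ampliation hA, traceFst_ampliation, h1, h2, h]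

theorem channelMutualInfo_krausMap {A : e → Matrix b a ℂ}
    (hA : ∀ X, (krausMap A X).trace = X.trace) {ρ : Matrix a a ℂ} (hρ : IsDensity ρ) :
    channelMutualInfo ρ (krausMap A) =
      entropy ρ + entropy (krausMap A ρ) - entropy (krausMap (krausSwap A) ρ) :=
  purificationMutualInfo_krausMap hA (isPurification_canonicalPurification hρ.1)

/-- The identity has a single Kraus operator, so its environment is one-dimensional and has no
entropy. -/
theorem channelMutualInfo_id {ρ : Matrix a a ℂ} (hρ : IsDensity ρ) :
    channelMutualInfo ρ LinearMap.id = 2 * entropy ρ := by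
  have e1 : (LinearMap.id : Matrix a a ℂ →ₗ[ℂ] Matrix a a ℂ) =
      krausMap fun _ : Unit => (1 : Matrix a a ℂ) := by
    ext X : 1; simp [krausMap_apply]
  have hA : ∀ X, (krausMap (fun _ : Unit => (1 : Matrix a a ℂ)) X).trace = X.trace := by
    intro X; rw [← e1]; rfl
  have e2 : krausMap (krausSwap fun _ : Unit => (1 : Matrix a a ℂ)) ρ = 1 := by
    ext i j
    rw [krausMap_krausSwap_apply]
    simp [hρ.2]
  have e3 : entropy (1 : Matrix Unit Unit ℂ) = 0 := by
    have := entropy_unitary_diagonal (U := (1 : Matrix Unit Unit ℂ)) (by simp) (fun _ => 1)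
    simpa using this
  rw [e1, channelMutualInfo_krausMap hA hρ, e2, e3, ← e1]
  simp only [LinearMap.id_apply]
  ring

/-- The mutual informations of a quantum operation and of its complement add up to that of the
identity. -/
theorem channelMutualInfo_add_krausSwap {A : e → Matrix b a ℂ}
    (hA : ∀ X, (krausMap A X).trace = X.trace) {ρ : Matrix a a ℂ} (hρ : IsDensity ρ) :
    channelMutualInfo ρ (krausMap A) + channelMutualInfo ρ (krausMap (krausSwap A)) =
      channelMutualInfo ρ LinearMap.id := by
  have hA' : ∀ X, (krausMap (krausSwap A) X).trace = X.trace := fun X =>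
    (trace_krausMap_krausSwap A X).trans (hA X)
  rw [channelMutualInfo_krausMap hA hρ, channelMutualInfo_krausMap hA' hρ, channelMutualInfo_id hρ]
  -- `krausSwap` is an involution by definition, so the environment of the complement is the
  -- original output.
  change _ + (_ + _ - entropy (krausMap A ρ)) = _
  ring

end MutualInformation

/-! ### Vanishing operations and zero mutual information. -/

section Vanishing

theorem isDensity_pureState {a r : Type*} [Fintype a] [Fintype r] {Ψ : r × a → ℂ}
    {ρ : Matrix a a ℂ} (hρ : IsDensity ρ) (h : IsPurification Ψ ρ) : IsDensity (pureState Ψ) :=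
  ⟨posSemidef_pureState Ψ, by rw [← trace_traceFst, h, hρ.2]⟩

variable {a : Type u} {b : Type v} {e : Type*} [Fintype a] [DecidableEq a] [Fintype b]
  [DecidableEq b] [Fintype e] {K : Submodule ℂ (a → ℂ)} {A : e → Matrix b a ℂ}

theorem Vanishing.channelMutualInfo_eq_zero (h : Vanishing (krausMap A) (statesOn K))
    {ρ : Matrix a a ℂ} (hρ : ρ ∈ statesOn K) :
    channelMutualInfo ρ (krausMap A) = 0 := by
  obtain ⟨σ, hσ, h⟩ := h
  have hp := isPurification_canonicalPurification hρ.1.1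
  have h1 := eq_zero_of_forall_mem_statesOn
    (L := krausMap A - (traceLinearMap a ℂ ℂ).smulRight σ) (K := K) fun ρ hρ => by
      simp [h ρ hρ, hρ.1.2]
  have h2 := hp.ampliation_eq_zero h1 hρ.2
  rw [ampliation_sub, sub_eq_zero, ampliation_traceLinearMap_smulRight] at h2
  have hd := isDensity_pureState hρ.1 hp
  rw [channelMutualInfo, purificationMutualInfo, h2]
  exact mutualInfo_kronecker ⟨posSemidef_traceSnd hd.1, (trace_traceSnd _).trans hd.2⟩ hσ

theorem vanishing_of_channelMutualInfo_eq_zero (hA : ∀ X, (krausMap A X).trace = X.trace)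
    {ρ : Matrix a a ℂ} (hρ : IsDensity ρ) (h : channelMutualInfo ρ (krausMap A) = 0) :
    Vanishing (krausMap A) (statesOn (support ρ)) := by
  have hp := isPurification_canonicalPurification hρ.1
  have hd := isDensity_pureState hρ hp
  have hRB : IsDensity (ampliation a (krausMap A) (pureState (canonicalPurification ρ))) := by
    constructor
    · rw [ampliation_krausMap_pureState]
      exact posSemidef_self_mul_conjTranspose _
    · rw [← trace_traceSnd, traceSnd_ampliation hA, trace_traceSnd, hd.2]
  -- The product of the marginals is what the constant operation with value `krausMap A ρ` yields on
  -- the same purification.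
  have h1 := eq_kronecker_of_mutualInfo_eq_zero hRB h
  rw [traceSnd_ampliation hA, traceFst_ampliation, hp, ← ampliation_traceLinearMap_smulRight,
    ← sub_eq_zero, ← ampliation_sub] at h1
  refine ⟨krausMap A ρ, hρ.krausMap hA, fun τ hτ => ?_⟩
  have h2 := eq_zero_of_mem_statesOn (hp.eq_zero_of_ampliation_eq_zero h1) hτ
  rw [LinearMap.sub_apply, sub_eq_zero] at h2
  rw [h2]
  simp [hτ.1.2]

end Vanishing

/-! ### Duality between reversible and vanishing operations. -/

section Reversible

/-- A unitary change of the Kraus operators does not change the superoperator. -/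
theorem krausMap_krausSwap_mul {a b e : Type*} [Fintype a] [Fintype e]
    [DecidableEq e] (A : e → Matrix b a ℂ) {U : Matrix e e ℂ} (hU : U * Uᴴ = 1) :
    krausMap (krausSwap fun k => Uᴴ * krausSwap A k) = krausMap A := by
  ext X k k'
  change _ = krausMap (krausSwap (krausSwap A)) X k k'
  rw [krausMap_krausSwap_apply, krausMap_krausSwap_apply, conjTranspose_mul,
    conjTranspose_conjTranspose, ← Matrix.mul_assoc, trace_mul_comm, ← Matrix.mul_assoc,
    ← Matrix.mul_assoc, ← Matrix.mul_assoc, hU, Matrix.one_mul]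

/-- The columns of a matrix that form an orthonormal basis of a subspace. -/
theorem exists_isometry_range_eq {a : Type*} [Fintype a] (K : Submodule ℂ (a → ℂ)) :
    ∃ (n : ℕ) (T : Matrix a (Fin n) ℂ), Tᴴ * T = 1 ∧ LinearMap.range T.mulVecLin = K := by
  let W : (a → ℂ) ≃ₗ[ℂ] EuclideanSpace ℂ a := (WithLp.linearEquiv 2 ℂ (a → ℂ)).symm
  let K' : Submodule ℂ (EuclideanSpace ℂ a) := K.map W.toLinearMap
  let v := stdOrthonormalBasis ℂ K'
  refine ⟨_, of fun l p => (v p : EuclideanSpace ℂ a) l, ?_, ?_⟩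
  · ext p q
    have := (orthonormal_iff_ite.1 v.orthonormal) p q
    rw [one_apply, ← this, Submodule.coe_inner, EuclideanSpace.inner_eq_star_dotProduct,
      dotProduct_comm]
    rfl
  · rw [range_mulVecLin]
    have h1 : Submodule.span ℂ (Set.range fun p => (v p : EuclideanSpace ℂ a)) = K' := by
      have := congrArg (Submodule.map K'.subtype) v.toBasis.span_eq
      rw [Submodule.map_span, Submodule.map_top, Submodule.range_subtype, ← Set.range_comp] at this
      convert this using 3
      ext; simp
    have h2 := congrArg (Submodule.map W.symm.toLinearMap) h1
    rw [Submodule.map_span, ← Set.range_comp] at h2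
    have h3 : K'.map W.symm.toLinearMap = K := by
      simp [K', ← Submodule.map_comp]
    exact h2.trans h3

theorem exists_isDensity_support_eq {a : Type u} [Fintype a] {K : Submodule ℂ (a → ℂ)}
    (hK : K ≠ ⊥) : ∃ ρ : Matrix a a ℂ, IsDensity ρ ∧ support ρ = K := by
  obtain ⟨n, T, hT, hr⟩ := exists_isometry_range_eq K
  have hn : (0 : ℝ) < n := by
    rcases Nat.eq_zero_or_pos n with rfl | hn
    · exact absurd (hr.symm.trans (LinearMap.range_eq_bot.2 (Subsingleton.elim _ 0))) hK
    · exact_mod_cast hn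
  have hs : ((√(n : ℝ) : ℂ)) ≠ 0 := by
    exact_mod_cast (Real.sqrt_pos.2 hn).ne'
  -- The normalised projection onto `K`, factored as `N * Nᴴ` for `support_mul_conjTranspose`.
  refine ⟨(((√(n : ℝ) : ℂ))⁻¹ • T) * (((√(n : ℝ) : ℂ))⁻¹ • T)ᴴ,
    ⟨posSemidef_self_mul_conjTranspose _, ?_⟩, ?_⟩
  · rw [trace_mul_comm, conjTranspose_smul, Matrix.smul_mul, Matrix.mul_smul, smul_smul, hT,
      trace_smul, trace_one]
    simp only [star_inv₀, Complex.star_def, Complex.conj_ofReal, Fintype.card_fin, smul_eq_mul]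
    rw [← mul_inv, ← Complex.ofReal_mul, Real.mul_self_sqrt hn.le]
    push_cast
    exact inv_mul_cancel₀ (by exact_mod_cast hn.ne')
  · rw [support_mul_conjTranspose, ← range_mulVecLin]
    conv_rhs => rw [← hr]
    rw [show (((√(n : ℝ) : ℂ))⁻¹ • T).mulVecLin =
      ((√(n : ℝ) : ℂ))⁻¹ • T.mulVecLin by ext; simp]
    exact LinearMap.range_smul _ _ (inv_ne_zero hs)

variable {a : Type u} {b : Type v} {e : Type*} [Fintype a] [DecidableEq a] [Fintype b]
  [DecidableEq b] [Fintype e] [DecidableEq e] {K : Submodule ℂ (a → ℂ)}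

/-- A constant diagonal environment state means that on `K` the Kraus operators are `√(d l)` times
isometries with mutually orthogonal ranges. Recovery detects the range and undoes the isometry. -/
theorem reversible_of_krausSwap_eq_diagonal (hK : K ≠ ⊥) {A : e → Matrix b a ℂ} {d : e → ℝ}
    (hd : ∀ i, 0 ≤ d i) (hd1 : ∑ i, d i = 1)
    (h : ∀ ρ ∈ statesOn K, krausMap (krausSwap A) ρ = diagonal fun i => (d i : ℂ)) :
    Reversible (krausMap A) (statesOn K) := by
  obtain ⟨n, T, hT, hr⟩ := exists_isometry_range_eq K
  have h1 := eq_zero_of_forall_mem_statesOn (L := krausMap (krausSwap A) -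
    (traceLinearMap a ℂ ℂ).smulRight (diagonal fun i => (d i : ℂ))) (K := K) fun ρ hρ => by
      simp [h ρ hρ, hρ.1.2]
  have hcol : ∀ p, T.col p ∈ K := fun p => by
    rw [← hr, range_mulVecLin]; exact Submodule.subset_span ⟨p, rfl⟩
  -- The Knill–Laflamme conditions, read off from the environment state on |T_p⟩⟨T_q| for columns of
  -- `T`.
  have hG : ∀ l m, (A m * T)ᴴ * (A l * T) = if l = m then (d l : ℂ) • 1 else 0 := by
    intro l m
    ext q p
    have h2 := congrFun (congrFun (h1 _ (hcol p) _ (hcol q)) l) m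
    rw [LinearMap.sub_apply, Matrix.sub_apply, krausMap_krausSwap_apply, mul_vecMulVec,
      vecMulVec_mul, ← star_mulVec, trace_vecMulVec, Matrix.zero_apply, sub_eq_zero] at h2
    have h3 : ((A m * T)ᴴ * (A l * T)) q p = (A l *ᵥ T.col p) ⬝ᵥ star (A m *ᵥ T.col q) := by
      rw [dotProduct_comm]; rfl
    have h4 : T.col p ⬝ᵥ star (T.col q) = (1 : Matrix _ _ ℂ) q p := by
      rw [← hT, dotProduct_comm]; rfl
    rw [h3, h2, LinearMap.smulRight_apply, traceLinearMap_apply, trace_vecMulVec, h4]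
    by_cases hlm : l = m
    · subst hlm; simp [mul_comm]
    · simp [hlm]
  set s : e → ℂ := fun l => ((√(d l) : ℝ) : ℂ) with hs
  have hss : ∀ l, s l * s l = d l := fun l => by
    rw [hs, ← Complex.ofReal_mul, Real.mul_self_sqrt (hd l)]
  have hstar : ∀ l, star (s l) = s l := fun l => Complex.conj_ofReal _
  have hs0 : ∀ l, s l = 0 → A l * T = 0 := fun l hl => by
    have := hG l l
    rw [if_pos rfl, ← hss, hl, mul_zero, zero_smul] at this
    exact conjTranspose_mul_self_eq_zero.1 this
  -- The isometries. Where `s l = 0`, the convention `0⁻¹ = 0` makes `S l` zero; the factor `s l` in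
  -- `hSS` covers this case.
  set S : e → Matrix b (Fin n) ℂ := fun l => (s l)⁻¹ • (A l * T) with hSdef
  have hAS : ∀ l, A l * T = s l • S l := fun l => by
    by_cases hl : s l = 0
    · rw [hs0 l hl, hl, zero_smul]
    · rw [hSdef, smul_inv_smul₀ hl]
  have hSS : ∀ m l, s l • ((S m)ᴴ * S l) = if l = m then s l • 1 else 0 := by
    intro m l
    rw [← Matrix.mul_smul, ← hAS, hSdef]
    simp only [conjTranspose_smul, Matrix.smul_mul, hG]
    by_cases hlm : l = m
    · subst hlm
      simp only [if_true, star_inv₀, hstar, ← hss]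
      rw [smul_smul]
      by_cases hl : s l = 0
      · simp [hl]
      · rw [inv_mul_cancel_left₀ hl]
    · simp [hlm]
  -- The projection onto the orthogonal complement of all the ranges.
  set Q : Matrix b b ℂ := 1 - ∑ l, S l * (S l)ᴴ with hQ
  have hSz : ∀ l, s l = 0 → S l = 0 := fun l hl => by simp [hSdef, hl]
  have hQS : ∀ m, Q * S m = 0 := by
    intro m
    by_cases hm : s m = 0
    · rw [hSz m hm, Matrix.mul_zero]
    have : s m • (Q * S m) = 0 := by
      rw [hQ, Matrix.sub_mul, Matrix.sum_mul, smul_sub, Finset.smul_sum]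
      simp only [Matrix.mul_assoc, ← Matrix.mul_smul, hSS]
      rw [Finset.sum_eq_single m (fun l _ hl => by rw [if_neg hl.symm, Matrix.mul_zero]) (by simp),
        if_pos rfl]
      simp
    exact (smul_eq_zero.1 this).resolve_left hm
  have hQh : Qᴴ = Q := by
    simp [hQ, conjTranspose_sub, conjTranspose_sum]
  have hQQ : Q * Q = Q := by
    conv_lhs => rw [hQ]
    have : ∀ l, S l * (S l)ᴴ * Q = 0 := fun l => by
      rw [Matrix.mul_assoc, ← hQh, ← conjTranspose_mul, hQS]; simp
    rw [Matrix.sub_mul, Matrix.sum_mul, Finset.sum_eq_zero fun l _ => this l, Matrix.one_mul,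
      sub_zero]
  have hne : Nonempty a := by
    by_contra hcon
    rw [not_nonempty_iff] at hcon
    exact hK (Subsingleton.elim _ _)
  obtain ⟨a₀⟩ := hne
  -- The first family undoes `S l`. The second sends the complement to the basis state `a₀`, only to
  -- make the recovery trace preserving.
  let R : e ⊕ b → Matrix a b ℂ :=
    Sum.elim (fun l => T * (S l)ᴴ) (fun k => single a₀ k (1 : ℂ) * Q)
  have hR : ∑ j, (R j)ᴴ * R j = 1 := by
    have e1 : ∀ l, (R (Sum.inl l))ᴴ * R (Sum.inl l) = S l * (S l)ᴴ := fun l => by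
      simp only [R, Sum.elim_inl, conjTranspose_mul, conjTranspose_conjTranspose]
      rw [Matrix.mul_assoc, ← Matrix.mul_assoc _ T, hT, Matrix.one_mul]
    have e2 : ∀ k, (R (Sum.inr k))ᴴ * R (Sum.inr k) = Q * single k k 1 * Q := fun k => by
      simp only [R, Sum.elim_inr, conjTranspose_mul, hQh, conjTranspose_single, star_one]
      rw [Matrix.mul_assoc, ← Matrix.mul_assoc _ _ Q, single_mul_single_same, one_mul,
        Matrix.mul_assoc]
    rw [Fintype.sum_sum_type]
    simp only [e1, e2]
    rw [← Matrix.sum_mul, ← Matrix.mul_sum, sum_single_one, Matrix.mul_one, hQQ, hQ]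
    abel
  refine ⟨krausMap R, isQuantumOperation_krausMap hR, fun ρ hρ => ?_⟩
  have hRA1 : ∀ j l, R (Sum.inl j) * (A l * T) = if l = j then s l • T else 0 := fun j l => by
    simp only [R, Sum.elim_inl]
    rw [hAS, Matrix.mul_smul, Matrix.mul_assoc, ← Matrix.mul_smul, hSS]
    split_ifs <;> simp
  have hRA2 : ∀ k l, R (Sum.inr k) * (A l * T) = 0 := fun k l => by
    simp only [R, Sum.elim_inr]
    rw [hAS, Matrix.mul_smul, Matrix.mul_assoc, hQS]
    simp
  have hfin := eq_zero_of_mem_statesOn (L := krausMap R ∘ₗ krausMap A - LinearMap.id) (K := K)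
    (fun x hx y hy => by
      rw [← hr] at hx hy
      obtain ⟨x, rfl⟩ := hx
      obtain ⟨y, rfl⟩ := hy
      have e0 : vecMulVec (T.mulVecLin x) (star (T.mulVecLin y)) =
          T * vecMulVec x (star y) * Tᴴ := by
        rw [mul_vecMulVec, vecMulVec_mul, ← star_mulVec]; rfl
      rw [LinearMap.sub_apply, LinearMap.comp_apply, krausMap_comp, e0, krausMap_apply,
        LinearMap.id_apply, sub_eq_zero]
      have e1 : ∀ p : (e ⊕ b) × e, R p.1 * A p.2 * (T * vecMulVec x (star y) * Tᴴ) *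
          (R p.1 * A p.2)ᴴ = (R p.1 * (A p.2 * T)) * vecMulVec x (star y) *
            (R p.1 * (A p.2 * T))ᴴ := fun p => by
        simp only [conjTranspose_mul, Matrix.mul_assoc]
      simp only [e1]
      rw [Fintype.sum_prod_type, Fintype.sum_sum_type]
      simp only [hRA1, hRA2]
      have e2 : ∀ j l, (if l = j then s l • T else 0) * vecMulVec x (star y) *
          (if l = j then s l • T else 0)ᴴ =
          if l = j then (d l : ℂ) • (T * vecMulVec x (star y) * Tᴴ) else 0 := fun j l => by
        split_ifs
        · rw [conjTranspose_smul, hstar, Matrix.smul_mul, Matrix.smul_mul, Matrix.mul_smul,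
            smul_smul, hss]
        · simp
      simp only [e2, Finset.sum_ite_eq', Finset.mem_univ, if_true]
      rw [← Finset.sum_smul, ← Complex.ofReal_sum, hd1]
      simp) hρ
  rwa [LinearMap.sub_apply, sub_eq_zero] at hfin

/-- A quantum operation is reversible if its complement is vanishing. -/
theorem reversible_of_vanishing_krausSwap (hK : K ≠ ⊥) {A : e → Matrix b a ℂ}
    (h : Vanishing (krausMap (krausSwap A)) (statesOn K)) :
    Reversible (krausMap A) (statesOn K) := by
  obtain ⟨α, hα, h⟩ := h
  obtain ⟨U, hU, hU', hαU⟩ := exists_unitary_diagonal hα.1.1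
  -- Rotating the environment by `U` diagonalises its constant state and leaves the operation
  -- unchanged.
  rw [← krausMap_krausSwap_mul A hU']
  refine reversible_of_krausSwap_eq_diagonal hK hα.1.eigenvalues_nonneg
    (sum_eigenvalues_eq_one _ hα.2) fun ρ hρ => ?_
  have e1 : krausMap (fun k => Uᴴ * krausSwap A k) ρ = Uᴴ * krausMap (krausSwap A) ρ * U := by
    simp only [krausMap_apply, Matrix.mul_sum, Matrix.sum_mul, conjTranspose_mul,
      conjTranspose_conjTranspose, Matrix.mul_assoc]
  change krausMap (fun k => Uᴴ * krausSwap A k) ρ = _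
  rw [e1, h ρ hρ]
  conv_lhs => rw [hαU]
  simp only [Matrix.mul_assoc, hU, Matrix.mul_one]
  rw [← Matrix.mul_assoc, hU, Matrix.one_mul]

/-- The complement of a reversible quantum operation is vanishing. -/
theorem Reversible.vanishing_krausSwap (hK : K ≠ ⊥) {A : e → Matrix b a ℂ}
    (hA : ∀ X, (krausMap A X).trace = X.trace) (h : Reversible (krausMap A) (statesOn K)) :
    Vanishing (krausMap (krausSwap A)) (statesOn K) := by
  obtain ⟨R, hR, h⟩ := h
  obtain ⟨n, B, rfl, hB⟩ := hR.exists_krausMap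
  set C := fun p : Fin n × e => B p.1 * A p.2 with hC
  have hCA : ∀ X, krausMap C X = krausMap B (krausMap A X) := fun X => (krausMap_comp B A X).symm
  have hCt : ∀ X, (krausMap C X).trace = X.trace := fun X => by
    rw [hCA, hR.trace_preserving, hA]
  obtain ⟨ρ, hρ, hs⟩ := exists_isDensity_support_eq hK
  have hp := isPurification_canonicalPurification hρ.1
  have h1 := eq_zero_of_forall_mem_statesOn (L := krausMap C - LinearMap.id) (K := K)
    fun ρ hρ => by simp [hCA, h ρ hρ]
  have h2 := hp.ampliation_eq_zero h1 hs.le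
  rw [ampliation_sub, sub_eq_zero] at h2
  -- The composition acts on the purification as the identity, so its complement has no mutual
  -- information and is vanishing.
  have h3 : channelMutualInfo ρ (krausMap C) = channelMutualInfo ρ LinearMap.id := by
    rw [channelMutualInfo, purificationMutualInfo, h2]; rfl
  have h4 := channelMutualInfo_add_krausSwap hCt hρ
  rw [h3, add_eq_left] at h4
  obtain ⟨β, hβ, hv⟩ := vanishing_of_channelMutualInfo_eq_zero
    (fun X => (trace_krausMap_krausSwap C X).trans (hCt X)) hρ h4
  refine ⟨traceFst β, ⟨posSemidef_traceFst hβ.1, (trace_traceFst β).trans hβ.2⟩, fun τ hτ => ?_⟩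
  rw [← traceFst_krausMap_krausSwap_comp hB A τ, hv τ (hs.symm ▸ hτ)]

end Reversible

end QInfo

end

/-! ### The theorem. -/

open QInfo in
theorem theorem2 {a : Type u} {b : Type v} [Fintype a] [DecidableEq a] [Fintype b] [DecidableEq b]
    (E : Matrix a a ℂ →ₗ[ℂ] Matrix b b ℂ) (hE : IsQuantumOperation E)
    (K : Submodule ℂ (a → ℂ)) (hK : K ≠ ⊥) :
    -- `I(ρ, E)` does not depend on the purification
    (∀ ρ : Matrix a a ℂ, IsDensity ρ →
      ∀ (r : Type u) [Fintype r] [DecidableEq r] (Ψ : r × a → ℂ), IsPurification Ψ ρ →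
        purificationMutualInfo Ψ E = channelMutualInfo ρ E) ∧
    -- reversibility; the last two conditions are the entanglement transmission
    List.TFAE [
      Reversible E (statesOn K),
      ∀ ρ ∈ statesOn K, channelMutualInfo ρ E = channelMutualInfo ρ LinearMap.id,
      ∃ ρ : Matrix a a ℂ, IsDensity ρ ∧ support ρ = K ∧
        channelMutualInfo ρ E = channelMutualInfo ρ LinearMap.id,
      ∃ R : Matrix b b ℂ →ₗ[ℂ] Matrix a a ℂ, IsQuantumOperation R ∧
        ∀ ρ ∈ statesOn K, ∀ (r : Type u) [Fintype r] (Ψ : r × a → ℂ), IsPurification Ψ ρ →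
          ampliation r R (ampliation r E (pureState Ψ)) = pureState Ψ,
      ∃ ρ : Matrix a a ℂ, IsDensity ρ ∧ support ρ = K ∧
        ∃ (r : Type u) (_ : Fintype r) (Ψ : r × a → ℂ), IsPurification Ψ ρ ∧
          ∃ R : Matrix b b ℂ →ₗ[ℂ] Matrix a a ℂ, IsQuantumOperation R ∧
            ampliation r R (ampliation r E (pureState Ψ)) = pureState Ψ] ∧
    -- vanishing
    List.TFAE [
      Vanishing E (statesOn K),
      ∀ ρ ∈ statesOn K, channelMutualInfo ρ E = 0,
      ∃ ρ : Matrix a a ℂ, IsDensity ρ ∧ support ρ = K ∧ channelMutualInfo ρ E = 0] := by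
  obtain ⟨n, A, rfl, hAA⟩ := hE.exists_krausMap
  have hA : ∀ X, (krausMap A X).trace = X.trace := hE.trace_preserving
  refine ⟨fun ρ hρ r _ _ Ψ hΨ => ?_, ?_, ?_⟩
  · rw [purificationMutualInfo_krausMap hA hΨ, channelMutualInfo_krausMap hA hρ]
  -- The two mutual informations sum to that of the identity, so one is full iff the other is zero.
  · have hiff : ∀ ρ : Matrix a a ℂ, IsDensity ρ →
        (channelMutualInfo ρ (krausMap A) = channelMutualInfo ρ LinearMap.id ↔
          channelMutualInfo ρ (krausMap (krausSwap A)) = 0) := fun ρ hρ => by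
      rw [← channelMutualInfo_add_krausSwap hA hρ, left_eq_add]
    tfae_have 1 → 2 := fun h ρ hρ =>
      (hiff ρ hρ.1).2 ((h.vanishing_krausSwap hK hA).channelMutualInfo_eq_zero hρ)
    tfae_have 2 → 3 := fun h => by
      obtain ⟨ρ, hρ, hs⟩ := exists_isDensity_support_eq hK
      exact ⟨ρ, hρ, hs, h ρ ⟨hρ, hs.le⟩⟩
    tfae_have 3 → 1 := by
      rintro ⟨ρ, hρ, rfl, h⟩
      exact reversible_of_vanishing_krausSwap hK (vanishing_of_channelMutualInfo_eq_zero
        (fun X => (trace_krausMap_krausSwap A X).trans (hA X)) hρ ((hiff ρ hρ).1 h))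
    tfae_have 1 → 4 := by
      rintro ⟨R, hR, h⟩
      refine ⟨R, hR, fun ρ hρ r _ Ψ hΨ => ?_⟩
      have h1 := eq_zero_of_forall_mem_statesOn (L := R ∘ₗ krausMap A - LinearMap.id) (K := K)
        fun ρ hρ => by simp [h ρ hρ]
      exact sub_eq_zero.1 (hΨ.ampliation_eq_zero h1 hρ.2)
    tfae_have 4 → 5 := by
      rintro ⟨R, hR, h⟩
      obtain ⟨ρ, hρ, hs⟩ := exists_isDensity_support_eq hK
      have hp := isPurification_canonicalPurification hρ.1
      exact ⟨ρ, hρ, hs, a, inferInstance, _, hp, R, hR, h ρ ⟨hρ, hs.le⟩ a _ hp⟩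
    tfae_have 5 → 1 := by
      rintro ⟨ρ, hρ, rfl, r, _, Ψ, hΨ, R, hR, h⟩
      refine ⟨R, hR, fun τ hτ => ?_⟩
      have h1 : ampliation r (R ∘ₗ krausMap A - LinearMap.id) (pureState Ψ) = 0 := sub_eq_zero.2 h
      exact sub_eq_zero.1 (eq_zero_of_mem_statesOn (hΨ.eq_zero_of_ampliation_eq_zero h1) hτ)
    tfae_finish
  · tfae_have 1 → 2 := fun h ρ hρ => h.channelMutualInfo_eq_zero hρ
    tfae_have 2 → 3 := fun h => by
      obtain ⟨ρ, hρ, hs⟩ := exists_isDensity_support_eq hK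
      exact ⟨ρ, hρ, hs, h ρ ⟨hρ, hs.le⟩⟩
    tfae_have 3 → 1 := by
      rintro ⟨ρ, hρ, rfl, h⟩
      exact vanishing_of_channelMutualInfo_eq_zero hA hρ h
    tfae_finish
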